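/- Let $k$ be any field. Let $X$ be a finite set and $r:X\times X\to X\times X$, $r(x,y)=({}^xy,x^y)$, an involutive solution of the set-theoretic Yang–Baxter equation $r^{12}r^{23}r^{12}=r^{23}r^{12}r^{23}$ which is nondegenerate (all maps $\mathcal L_x:y\mapsto{}^xy$ and $\mathcal R_y:x\mapsto x^y$ are bijective) and square-free ($r(x,x)=(x,x)$). The retraction $\mathrm{Ret}(X,r)$ is the solution induced by $r$ on the quotient of $X$ by the relation $x\sim y\iff\mathcal L_x=\mathcal L_y$. Assume that $(X,r)$ is a multipermutation solution of level $2$, i.e. $2$ is the least $m$ such that $\mathrm{Ret}^m(X,r)$ has exactly one element. Let $\mathcal G\subseteq\mathrm{Sym}(X)$ be the group generated by all $\mathcal L_x$, let $X_1,\dots,X_t$ be its orbits on $X$, let $\mathcal G_i\subseteq\mathrm{Sym}(X_i)$ be the group generated by the restrictions $\mathcal L_x|_{X_i}$, $x\in X$, and let $\mathcal H=\prod_{i=1}^t\mathcal G_i$. Then all $x\in X_i$ act on $X_j$ by one and the same permutation, denoted $\sigma^i_j\in\mathcal G_j$; put $\gamma^i=(\sigma^i_j)_{1\le j\le t}\in\mathcal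 H$. Let $H=k(\mathcal H)\otimes k\mathcal H$, the tensor product of the Hopf algebra of $k$-valued functions on $\mathcal H$ and the group Hopf algebra of $\mathcal H$. Write $V=kX$, and $k[V]$ for the commutative polynomial algebra in the variables $x\in X$, containing $V$ in degree one. Then: 1. $V$ is a right $H$-comodule by $\Delta_R(x)=\sum_{\pi\in\mathcal G_i}\pi(x)\otimes(\delta_\pi\otimes\gamma^i)$ for $x\in X_i$, where $\delta_\pi\in k(\mathcal H)$ is the function with $\delta_\pi(h)=1$ if the $i$-th component of $h$ is $\pi$, and $\delta_\pi(h)=0$ otherwise. This coaction extends to an algebra map $\Delta_R:k[V]\to k[V]\otimes H$, making $k[V]$ a right $H$-comodule algebra. 2. The linear map $\mathcal F:H\otimes H\to k$, $\mathcal F((f\otimes h)\otimes(f'\otimes h'))=\epsilon(f)\,\epsilon(h')\,f'(h)$ for $f,f'\in k(\mathcal H)$, $h,h'\in k\mathcal H$ (with $\epsilon$ the counits and $f'$ extended linearly to $k\mathcal H$), is a Hopf algebra $2$-cocycle: it is convolution-invertible, satisfies $\mathcal F(1\otimes a)=\epsilon(a)=\mathcal F(a\otimes1)$, and $\sum\mathcal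 F(a_{(1)}\otimes b_{(1)})\mathcal F(a_{(2)}b_{(2)}\otimes c)=\sum\mathcal F(b_{(1)}\otimes c_{(1)})\mathcal F(a\otimes b_{(2)}c_{(2)})$ for all $a,b,c\in H$. 3. The cotwisted product $f\bullet g=\sum f^{(1)}g^{(1)}\,\mathcal F(f^{(2)}\otimes g^{(2)})$, where $\Delta_Rf=\sum f^{(1)}\otimes f^{(2)}$, is associative on the vector space $k[V]$ and has unit $1$; the resulting algebra is denoted $k[V]^{\mathcal F}$. For $x\in X_i$ and $y\in X_j$ one has $x\bullet y=x\,\sigma^i_j(y)$. 4. Let $R:V\otimes V\to V\otimes V$ be the linear extension $R(x\otimes y)={}^xy\otimes x^y$ of $r$, let $k_R[V]$ be the quotient of the tensor algebra of $V$ by the ideal generated by all $v\otimes w-R(v\otimes w)$, $v,w\in V$, and let $\mathcal A(k,X,r)$ be the quotient of the free associative unital $k$-algebra $k\langle X\rangle$ by the relations $xy=zt$ whenever $r(x,y)=(z,t)$. Then the identity on $V$, respectively on $X$, extends to isomorphisms of algebras $k_R[V]\cong k[V]^{\mathcal F}$ and $\mathcal A(k,X,r)\cong k[V]^{\mathcal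 F}$. -/

import Mathlib

open scoped TensorProduct

universe u v

/-! ## Nondegenerate square-free symmetric sets -/

/-- A nondegenerate square-free symmetric set: an involutive nondegenerate solution
`r : X × X → X × X` of the set-theoretic Yang-Baxter equation with `r (x, x) = (x, x)`.
We write `r (x, y) = (left x y, right y x)`, i.e. `left x y` is `ˣy` and `right y x` is `xʸ`.
(Involutivity makes `r` bijective.) -/
structure SquareFreeSymmetricSet (X : Type u) where
  /-- the solution -/
  r : X × X → X × X
  involutive : ∀ p, r (r p) = p
  left_bijective : ∀ x, Function.Bijective fun y => (r (x, y)).1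
  right_bijective : ∀ y, Function.Bijective fun x => (r (x, y)).2
  squareFree : ∀ x, r (x, x) = (x, x)
  /-- `r¹² r²³ r¹² = r²³ r¹² r²³` on `X × X × X`, where
  `r¹² (x, y, z) = ((r (x, y)).1, (r (x, y)).2, z)` and `r²³ (x, y, z) = (x, r (y, z))`. -/
  braid :
    let r12 : X × X × X → X × X × X := fun t =>
      ((r (t.1, t.2.1)).1, (r (t.1, t.2.1)).2, t.2.2)
    let r23 : X × X × X → X × X × X := fun t => (t.1, r t.2)
    r12 ∘ r23 ∘ r12 = r23 ∘ r12 ∘ r23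

/-- `(Y, s)` is, through the projection `p : X → Y`, the retraction of the quadratic set `(X, r)`:
`p` is surjective, it identifies `x` and `x'` exactly when the left actions `ˣ(-)` and `ˣ'(-)`
coincide, and `s` is the map induced by `r`, that is `s ([x], [y]) = ([ˣy], [xʸ])`.
For a nondegenerate symmetric set such `(Y, s)` exists and is unique up to isomorphism. -/
structure IsRetraction {X Y : Type u} (r : X × X → X × X) (s : Y × Y → Y × Y) (p : X → Y) :
    Prop where
  surjective : Function.Surjective p
  eq_iff : ∀ x x', p x = p x' ↔ ∀ z, (r (x, z)).1 = (r (x', z)).1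
  map_eq : ∀ x y, s (p x, p y) = (p (r (x, y)).1, p (r (x, y)).2)

/-- The `m`-th iterated retraction of `(X, r)` is a solution on a one-element set. -/
def IteratedRetractionIsPoint : ℕ → ∀ X : Type u, (X × X → X × X) → Prop
  | 0, X, _ => Nonempty X ∧ Subsingleton X
  | m + 1, X, r => ∃ (Y : Type u) (s : Y × Y → Y × Y) (p : X → Y),
      IsRetraction r s p ∧ IteratedRetractionIsPoint m Y s

/-- `(X, r)` is a multipermutation solution of level `m`: `m` is the least number such that the
`m`-th iterated retraction is a one-element solution. -/
def IsMultipermutationOfLevel (m : ℕ) {X : Type u} (r : X × X → X × X) : Prop :=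
  IteratedRetractionIsPoint m X r ∧ ∀ l < m, ¬ IteratedRetractionIsPoint l X r

/-! ## Hopf algebra notions -/

/-- `ρ : V → V ⊗ H` is a right coaction of the coalgebra `H` on `V`. -/
structure IsRightComodule {k : Type*} [CommSemiring k] {V H : Type*} [AddCommMonoid V] [Module k V]
    [AddCommMonoid H] [Module k H] [Coalgebra k H] (ρ : V →ₗ[k] V ⊗[k] H) : Prop where
  coassoc : (TensorProduct.assoc k V H H).toLinearMap ∘ₗ ρ.rTensor H ∘ₗ ρ =
    (Coalgebra.comul (R := k) (A := H)).lTensor V ∘ₗ ρ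
  counit : (TensorProduct.rid k V).toLinearMap ∘ₗ (Coalgebra.counit (R := k) (A := H)).lTensor V ∘ₗ ρ
    = LinearMap.id

/-- A Hopf algebra 2-cocycle on `H`: a convolution-invertible linear map `F : H ⊗ H → k` which is
unital and satisfies
`∑ F (a₁ ⊗ b₁) F (a₂ b₂ ⊗ c) = ∑ F (b₁ ⊗ c₁) F (a ⊗ b₂ c₂)`.
The products below are convolution products of `k`-valued functions on tensor powers of `H`. -/
structure IsHopfTwoCocycle {k : Type*} [CommRing k] {H : Type*} [Ring H] [Bialgebra k H]
    (F : H ⊗[k] H →ₗ[k] k) : Prop where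
  isUnit : IsUnit (WithConv.toConv F)
  one_left : ∀ a, F (1 ⊗ₜ a) = Coalgebra.counit (R := k) a
  one_right : ∀ a, F (a ⊗ₜ 1) = Coalgebra.counit (R := k) a
  /-- with `F₁₂ = F ⊗ ε` and `F₂₃ = ε ⊗ F`:
  `F₁₂ * (F ∘ (m ⊗ id)) = F₂₃ * (F ∘ (id ⊗ m))` on `H ⊗ (H ⊗ H)` -/
  cocycle :
    let ε := Coalgebra.counit (R := k) (A := H)
    let m := LinearMap.mul' k H
    let F₁₂ : H ⊗[k] (H ⊗[k] H) →ₗ[k] k :=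
      LinearMap.mul' k k ∘ₗ TensorProduct.map F ε ∘ₗ (TensorProduct.assoc k H H H).symm.toLinearMap
    let F₂₃ : H ⊗[k] (H ⊗[k] H) →ₗ[k] k := LinearMap.mul' k k ∘ₗ TensorProduct.map ε F
    WithConv.toConv F₁₂ *
        WithConv.toConv (F ∘ₗ m.rTensor H ∘ₗ (TensorProduct.assoc k H H H).symm.toLinearMap) =
      WithConv.toConv F₂₃ * WithConv.toConv (F ∘ₗ m.lTensor H)

/-- The cotwisted product `f • g = ∑ f⁽¹⁾ g⁽¹⁾ F (f⁽²⁾ ⊗ g⁽²⁾)` on an algebra `A` with right coaction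
`ρ f = ∑ f⁽¹⁾ ⊗ f⁽²⁾` of `H`, as a bilinear map. -/
noncomputable def cotwistMul {k : Type*} [CommRing k] {A H : Type*} [Ring A] [Algebra k A]
    [AddCommGroup H] [Module k H] (ρ : A →ₗ[k] A ⊗[k] H) (F : H ⊗[k] H →ₗ[k] k) :
    A →ₗ[k] A →ₗ[k] A :=
  TensorProduct.curry ((TensorProduct.rid k A).toLinearMap ∘ₗ
    TensorProduct.map (LinearMap.mul' k A) F ∘ₗ
    (TensorProduct.tensorTensorTensorComm k A H A H).toLinearMap ∘ₗ TensorProduct.map ρ ρ)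

/-- The algebra `k(G)` of all `k`-valued functions on a finite group `G`, with pointwise product. -/
def FunctionAlgebra (k : Type v) (G : Type u) : Type (max u v) := G → k

namespace FunctionAlgebra

variable (k : Type v) [Field k] (G : Type u)

noncomputable instance : CommRing (FunctionAlgebra k G) := inferInstanceAs (CommRing (G → k))

noncomputable instance : Algebra k (FunctionAlgebra k G) := inferInstanceAs (Algebra k (G → k))

variable {G}

/-- Evaluation at a point. -/
noncomputable def eval (g : G) : FunctionAlgebra k G →ₐ[k] k := Pi.evalAlgHom k (fun _ : G => k) g

@[ext] theorem ext_eval {f f' : FunctionAlgebra k G} (h : ∀ g, eval k g f = eval k g f') : f = f' :=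
  funext h

open Classical in
/-- The Kronecker delta function. -/
noncomputable def delta (g : G) : FunctionAlgebra k G := fun h => if h = g then 1 else 0

open Classical in
theorem eval_delta (g h : G) : eval k h (delta k g) = if h = g then 1 else 0 := rfl

/-- Pullback of functions along a map. -/
noncomputable def comap {G' : Type*} (p : G' → G) : FunctionAlgebra k G →ₐ[k] FunctionAlgebra k G' where
  toFun f := fun g => f (p g)
  map_one' := rfl
  map_mul' _ _ := rfl
  map_zero' := rfl
  map_add' _ _ := rfl
  commutes' _ := rfl

theorem eval_comap {G' : Type*} (p : G' → G) (g : G') (f : FunctionAlgebra k G) :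
    eval k g (comap k p f) = eval k (p g) f := rfl

/-- The linear form `f ⊗ t ↦ f a * φ t` on `k(G) ⊗ B`, for an algebra map `φ : B → k`. -/
noncomputable def evalTensor {B : Type*} [Ring B] [Algebra k B] (a : G) (φ : B →ₐ[k] k) :
    FunctionAlgebra k G ⊗[k] B →ₐ[k] k :=
  Algebra.TensorProduct.lift (eval k a) φ fun _ _ => Commute.all _ _

theorem evalTensor_tmul {B : Type*} [Ring B] [Algebra k B] (a : G) (φ : B →ₐ[k] k)
    (f : FunctionAlgebra k G) (t : B) : evalTensor k a φ (f ⊗ₜ t) = eval k a f * φ t := by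
  rw [evalTensor, Algebra.TensorProduct.lift_tmul]

theorem evalTensor_assoc {B : Type*} [Ring B] [Algebra k B] (a b : G) (φ : B →ₐ[k] k) (c : B)
    (t : FunctionAlgebra k G ⊗[k] FunctionAlgebra k G) :
    evalTensor k a (evalTensor k b φ) (TensorProduct.assoc k _ _ B (t ⊗ₜ c)) =
      evalTensor k a (eval k b) t * φ c := by
  induction t with
  | zero => simp
  | add x y hx hy => simp [TensorProduct.add_tmul, hx, hy, add_mul]
  | tmul f m => simp [evalTensor_tmul, mul_assoc]

theorem eq_sum_delta [Fintype G] (f : FunctionAlgebra k G) : f = ∑ g, eval k g f • delta k g := by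
  classical
  ext h
  simp [map_sum, eval_delta]

theorem eq_sum_delta_tmul {M : Type*} [AddCommGroup M] [Module k M] [Fintype G]
    (t : FunctionAlgebra k G ⊗[k] M) :
    t = ∑ g, delta k g ⊗ₜ TensorProduct.lid k M ((eval k g).toLinearMap.rTensor M t) := by
  induction t with
  | zero => simp
  | add x y hx hy =>
    conv_lhs => rw [hx, hy]
    simp [TensorProduct.tmul_add, Finset.sum_add_distrib]
  | tmul f m =>
    conv_lhs => rw [eq_sum_delta k f]
    simp [TensorProduct.sum_tmul, TensorProduct.smul_tmul]

/-- If the algebra maps `φ i : B → k` separate the elements of `B`, then the `eval a ⊗ φ i`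
separate the elements of `k(G) ⊗ B`. -/
theorem ext_evalTensor [Finite G] {B ι : Type*} [Ring B] [Algebra k B] (φ : ι → B →ₐ[k] k)
    (hφ : ∀ b b' : B, (∀ i, φ i b = φ i b') → b = b') (t t' : FunctionAlgebra k G ⊗[k] B)
    (h : ∀ a i, evalTensor k a (φ i) t = evalTensor k a (φ i) t') : t = t' := by
  have := Fintype.ofFinite G
  have key : ∀ a i (t : FunctionAlgebra k G ⊗[k] B),
      φ i (TensorProduct.lid k B ((eval k a).toLinearMap.rTensor B t)) =
        evalTensor k a (φ i) t := by
    intro a i t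
    induction t with
    | zero => simp
    | add x y hx hy => simp [hx, hy]
    | tmul f m => simp [evalTensor_tmul]
  rw [eq_sum_delta_tmul k t, eq_sum_delta_tmul k t']
  refine Finset.sum_congr rfl fun a _ => congrArg (fun b => delta k a ⊗ₜ[k] b) ?_
  exact hφ _ _ fun i => by rw [key, key, h]

theorem ext_eval₂ [Finite G] (t t' : FunctionAlgebra k G ⊗[k] FunctionAlgebra k G)
    (h : ∀ a b, evalTensor k a (eval k b) t = evalTensor k a (eval k b) t') : t = t' :=
  ext_evalTensor k (eval k) (fun _ _ => ext_eval k) t t' h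

variable [Finite G] [Group G]

/-- The coproduct of `k(G)`: under `k(G) ⊗ k(G) = k(G × G)`, `(Δ f)(a, b) = f (a b)`. -/
noncomputable def comulFun (f : FunctionAlgebra k G) :
    FunctionAlgebra k G ⊗[k] FunctionAlgebra k G :=
  letI := Fintype.ofFinite G
  ∑ a : G, ∑ b : G, eval k (a * b) f • (delta k a ⊗ₜ[k] delta k b)

theorem evalTensor_comulFun (a b : G) (f : FunctionAlgebra k G) :
    evalTensor k a (eval k b) (comulFun k f) = eval k (a * b) f := by
  classical
  simp [comulFun, map_sum, evalTensor_tmul, eval_delta]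

/-- The coproduct of `k(G)` as an algebra map. -/
noncomputable def comulHom :
    FunctionAlgebra k G →ₐ[k] FunctionAlgebra k G ⊗[k] FunctionAlgebra k G where
  toFun := comulFun k
  map_one' := ext_eval₂ k _ _ fun a b => by simp [evalTensor_comulFun]
  map_mul' f f' := ext_eval₂ k _ _ fun a b => by simp [evalTensor_comulFun]
  map_zero' := ext_eval₂ k _ _ fun a b => by simp [evalTensor_comulFun]
  map_add' f f' := ext_eval₂ k _ _ fun a b => by simp [evalTensor_comulFun]
  commutes' c := ext_eval₂ k _ _ fun a b => by
    rw [evalTensor_comulFun, AlgHom.commutes, AlgHom.commutes]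

theorem evalTensor_comulHom (a b : G) (f : FunctionAlgebra k G) :
    evalTensor k a (eval k b) (comulHom k f) = eval k (a * b) f := evalTensor_comulFun k a b f

/-- The bialgebra `k(G)`, with counit `ε f = f e`. -/
noncomputable instance : Bialgebra k (FunctionAlgebra k G) :=
  Bialgebra.ofAlgHom (comulHom k) (eval k 1)
    (by
      ext f
      refine ext_evalTensor k (fun p : G × G => evalTensor k p.1 (eval k p.2))
        (fun t t' h => ext_eval₂ k t t' fun a b => h (a, b)) _ _ fun a p => ?_
      have h1 : ∀ t, evalTensor k a (evalTensor k p.1 (eval k p.2))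
          (TensorProduct.assoc k _ _ _
            (Algebra.TensorProduct.map (comulHom k) (.id k (FunctionAlgebra k G)) t)) =
          evalTensor k (a * p.1) (eval k p.2) t := by
        intro t
        induction t with
        | zero => simp
        | add x y hx hy => simp [hx, hy]
        | tmul f m =>
          rw [Algebra.TensorProduct.map_tmul, evalTensor_assoc, evalTensor_comulHom,
            evalTensor_tmul]
          rfl
      have h2 : (evalTensor k a (evalTensor k p.1 (eval k p.2))).comp
            (Algebra.TensorProduct.map (.id k (FunctionAlgebra k G)) (comulHom k)) =
          evalTensor k a (eval k (p.1 * p.2)) := by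
        ext f <;> simp [evalTensor_tmul, evalTensor_comulHom]
      have e2 := congr($h2 (comulHom k f))
      simp only [AlgHom.comp_apply, evalTensor_comulHom] at e2 ⊢
      rw [e2, ← mul_assoc, ← evalTensor_comulHom, ← h1]
      rfl)
    (by
      ext f
      refine (TensorProduct.lid k (FunctionAlgebra k G)).injective (ext_eval k fun b => ?_)
      have h1 : ∀ t : FunctionAlgebra k G ⊗[k] FunctionAlgebra k G, eval k b (TensorProduct.lid k _
          (Algebra.TensorProduct.map (eval k 1) (.id k (FunctionAlgebra k G)) t)) =
          evalTensor k 1 (eval k b) t := by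
        intro t
        induction t with
        | zero => simp
        | add x y hx hy => simp [hx, hy]
        | tmul f m => simp [evalTensor_tmul]
      rw [AlgHom.comp_apply, h1, evalTensor_comulHom, one_mul]
      simp)
    (by
      ext f
      refine (TensorProduct.rid k (FunctionAlgebra k G)).injective (ext_eval k fun b => ?_)
      have h1 : ∀ t : FunctionAlgebra k G ⊗[k] FunctionAlgebra k G, eval k b (TensorProduct.rid k _
          (Algebra.TensorProduct.map (.id k (FunctionAlgebra k G)) (eval k 1) t)) =
          evalTensor k b (eval k 1) t := by
        intro t
        induction t with
        | zero => simp
        | add x y hx hy => simp [hx, hy]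
        | tmul f m => simp [evalTensor_tmul, mul_comm]
      rw [AlgHom.comp_apply, h1, evalTensor_comulHom, mul_one]
      simp)

theorem counit_apply (f : FunctionAlgebra k G) : Coalgebra.counit (R := k) f = eval k 1 f := rfl

theorem evalTensor_comul (a b : G) (f : FunctionAlgebra k G) :
    evalTensor k a (eval k b) (Coalgebra.comul (R := k) f) = eval k (a * b) f :=
  evalTensor_comulFun k a b f

/-- The Hopf algebra `k(G)`, with antipode `(S f) g = f g⁻¹`. -/
noncomputable instance : HopfAlgebra k (FunctionAlgebra k G) where
  antipode := (comap k (fun g : G => g⁻¹)).toLinearMap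
  mul_antipode_rTensor_comul := by
    ext f g
    have h1 : ∀ t, eval k g (LinearMap.mul' k _
        ((comap k (fun g : G => g⁻¹)).toLinearMap.rTensor _ t)) = evalTensor k g⁻¹ (eval k g) t := by
      intro t
      induction t with
      | zero => simp
      | add x y hx hy => simp [hx, hy]
      | tmul f m => simp [evalTensor_tmul, eval_comap]
    simp only [LinearMap.comp_apply]
    rw [h1, evalTensor_comul, inv_mul_cancel, counit_apply, Algebra.linearMap_apply,
      AlgHom.commutes]
    rfl
  mul_antipode_lTensor_comul := by
    ext f g
    have h1 : ∀ t, eval k g (LinearMap.mul' k _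
        ((comap k (fun g : G => g⁻¹)).toLinearMap.lTensor _ t)) = evalTensor k g (eval k g⁻¹) t := by
      intro t
      induction t with
      | zero => simp
      | add x y hx hy => simp [hx, hy]
      | tmul f m => simp [evalTensor_tmul, eval_comap]
    simp only [LinearMap.comp_apply]
    rw [h1, evalTensor_comul, mul_inv_cancel, counit_apply, Algebra.linearMap_apply,
      AlgHom.commutes]
    rfl

end FunctionAlgebra

/-! ## The Hopf algebra `k(G) ⊗ kG` and its canonical 2-cocycle -/

/-- The tensor product Hopf algebra `k(G) ⊗ kG` of the function algebra and the group algebra. -/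
abbrev DoubleAlgebra (k : Type v) [Field k] (G : Type u) [Group G] : Type (max u v) :=
  FunctionAlgebra k G ⊗[k] MonoidAlgebra k G

/-- `h ↦ (f ↦ f h)`, extended linearly to `h ∈ kG`. -/
noncomputable def evalPairing (k : Type v) [Field k] (G : Type u) [Group G] :
    MonoidAlgebra k G →ₗ[k] FunctionAlgebra k G →ₗ[k] k :=
  Finsupp.linearCombination k (fun g : G => (FunctionAlgebra.eval k g).toLinearMap) ∘ₗ
    (MonoidAlgebra.coeffLinearEquiv k).toLinearMap

/-- The canonical map `F ((f ⊗ h) ⊗ (f' ⊗ h')) = ε(f) ε(h') f'(h)`. -/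
noncomputable def canonicalCocycle (k : Type v) [Field k] (G : Type u) [Group G] [Finite G] :
    DoubleAlgebra k G ⊗[k] DoubleAlgebra k G →ₗ[k] k :=
  TensorProduct.lift ((evalPairing k G).compl₁₂
    -- `f ⊗ h ↦ ε(f) h`
    ((TensorProduct.lid k (MonoidAlgebra k G)).toLinearMap ∘ₗ
      (Coalgebra.counit (R := k) (A := FunctionAlgebra k G)).rTensor (MonoidAlgebra k G))
    -- `f' ⊗ h' ↦ ε(h') f'`
    ((TensorProduct.rid k (FunctionAlgebra k G)).toLinearMap ∘ₗ
      (Coalgebra.counit (R := k) (A := MonoidAlgebra k G)).lTensor (FunctionAlgebra k G)))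

theorem canonicalCocycle_apply (k : Type v) [Field k] (G : Type u) [Group G] [Finite G]
    (f f' : FunctionAlgebra k G) (h h' : G) :
    canonicalCocycle k G ((f ⊗ₜ MonoidAlgebra.single h 1) ⊗ₜ (f' ⊗ₜ MonoidAlgebra.single h' 1)) =
      FunctionAlgebra.eval k 1 f * FunctionAlgebra.eval k h f' := by
  simp [canonicalCocycle, evalPairing, FunctionAlgebra.counit_apply]

namespace SquareFreeSymmetricSet

variable {X : Type u} (S : SquareFreeSymmetricSet X)

/-- The left action `ℒ x : y ↦ ˣy`, a permutation of `X`. -/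
noncomputable def left (x : X) : Equiv.Perm X := Equiv.ofBijective _ (S.left_bijective x)

theorem left_apply (x y : X) : S.left x y = (S.r (x, y)).1 := rfl

/-- The group `𝒢(X, r)` of left actions. -/
def permGroup : Subgroup (Equiv.Perm X) := Subgroup.closure (Set.range S.left)

/-- The index set of the orbits of the left action on `X`. -/
abbrev OrbitIndex : Type u := MulAction.orbitRel.Quotient S.permGroup X

/-- The index of the orbit containing `x`. -/
def orbitOf (x : X) : S.OrbitIndex := Quotient.mk _ x

/-- The orbit `X_i`. -/
abbrev Orbit (i : S.OrbitIndex) : Type u := {x : X // S.orbitOf x = i}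

theorem orbitOf_left (x y : X) : S.orbitOf (S.left x y) = S.orbitOf y :=
  Quotient.sound ⟨⟨S.left x, Subgroup.subset_closure ⟨x, rfl⟩⟩, rfl⟩

/-- The restriction `ℒ x|_{X_i}`, a permutation of the orbit `X_i`. -/
noncomputable def leftRestrict (x : X) (i : S.OrbitIndex) : Equiv.Perm (S.Orbit i) :=
  (S.left x).subtypePerm fun y => by rw [S.orbitOf_left x y]

/-- The group `𝒢_i`, generated in `Sym(X_i)` by the restrictions `ℒ x|_{X_i}`, `x ∈ X`. -/
def orbitGroup (i : S.OrbitIndex) : Subgroup (Equiv.Perm (S.Orbit i)) :=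
  Subgroup.closure (Set.range fun x => S.leftRestrict x i)

/-- `ℋ = ∏ i, 𝒢_i`. -/
abbrev ProdGroup : Type u := ∀ i : S.OrbitIndex, S.orbitGroup i

/-- `σ^i_j ∈ 𝒢_j`: the permutation by which an element of `X_i` acts on `X_j`. It is computed here
with a chosen element of `X_i`; for solutions of level 2 all elements of `X_i` act alike. -/
noncomputable def sigma (i j : S.OrbitIndex) : S.orbitGroup j :=
  ⟨S.leftRestrict i.out j, Subgroup.subset_closure ⟨i.out, rfl⟩⟩

/-- `γ^i = ∏ j, σ^i_j ∈ ℋ`. -/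
noncomputable def gamma (i : S.OrbitIndex) : S.ProdGroup := fun j => S.sigma i j

section Linear

variable (k : Type v) [Field k]

/-- The Hopf algebra `H = k(ℋ) ⊗ kℋ`. -/
abbrev H : Type (max u v) := DoubleAlgebra k S.ProdGroup

/-- For `π ∈ 𝒢_i`, the function `δ_π ∈ k(𝒢_i)` viewed in `k(ℋ)`, i.e. `h ↦ δ_π (h_i)`. -/
noncomputable def deltaAt (i : S.OrbitIndex) (π : S.orbitGroup i) : FunctionAlgebra k S.ProdGroup :=
  FunctionAlgebra.comap k (fun h : S.ProdGroup => h i) (FunctionAlgebra.delta k π)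

/-- The coaction `V → V ⊗ H` on `V = kX`,
`x ↦ ∑_{π ∈ 𝒢_i} π(x) ⊗ (δ_π ⊗ γ^i)` for `x ∈ X_i`, extended linearly. -/
noncomputable def coaction [Finite X] : (X →₀ k) →ₗ[k] (X →₀ k) ⊗[k] S.H k :=
  letI (i : S.OrbitIndex) : Fintype (S.orbitGroup i) := Fintype.ofFinite _
  Finsupp.linearCombination k fun x : X =>
    ∑ π : S.orbitGroup (S.orbitOf x),
      (Finsupp.single ((π.1 ⟨x, rfl⟩ : S.Orbit (S.orbitOf x)) : X) (1 : k)) ⊗ₜ[k]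
        (S.deltaAt k (S.orbitOf x) π ⊗ₜ[k]
          MonoidAlgebra.single (S.gamma (S.orbitOf x)) (1 : k))

/-- The linear extension `R : V ⊗ V → V ⊗ V` of `r`, `R (x ⊗ y) = ˣy ⊗ xʸ`. -/
noncomputable def linearR : (X →₀ k) ⊗[k] (X →₀ k) →ₗ[k] (X →₀ k) ⊗[k] (X →₀ k) :=
  TensorProduct.lift (Finsupp.linearCombination k fun x => Finsupp.linearCombination k fun y =>
    Finsupp.single (S.r (x, y)).1 (1 : k) ⊗ₜ[k] Finsupp.single (S.r (x, y)).2 (1 : k))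

/-- The defining relations `x y = z t`, whenever `r (x, y) = (z, t)`, of the Yang–Baxter algebra. -/
inductive YBRel : FreeAlgebra k X → FreeAlgebra k X → Prop
  | of (x y z t : X) (h : S.r (x, y) = (z, t)) :
      YBRel (FreeAlgebra.ι k x * FreeAlgebra.ι k y) (FreeAlgebra.ι k z * FreeAlgebra.ι k t)

/-- The Yang–Baxter algebra `𝒜(k, X, r) = k⟨X ; ℜ(r)⟩`. -/
abbrev YBAlgebra : Type (max u v) := RingQuot (S.YBRel k)

/-- The generator of `𝒜(k, X, r)` given by `x ∈ X`. -/
noncomputable def YBAlgebra.gen (x : X) : S.YBAlgebra k :=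
  RingQuot.mkAlgHom k (S.YBRel k) (FreeAlgebra.ι k x)

end Linear

end SquareFreeSymmetricSet

section QuantumSpace

variable {k : Type v} [Field k] {V : Type*} [AddCommGroup V] [Module k V]

/-- The product `V ⊗ V → T V` in the tensor algebra. -/
noncomputable def tensorMul : V ⊗[k] V →ₗ[k] TensorAlgebra k V :=
  LinearMap.mul' k (TensorAlgebra k V) ∘ₗ
    TensorProduct.map (TensorAlgebra.ι k) (TensorAlgebra.ι k)

/-- The relations `v ⊗ w = R (v ⊗ w)` in the tensor algebra. -/
inductive QuantumRel (R : V ⊗[k] V →ₗ[k] V ⊗[k] V) : TensorAlgebra k V → TensorAlgebra k V → Prop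
  | of (v w : V) : QuantumRel R (tensorMul (v ⊗ₜ[k] w)) (tensorMul (R (v ⊗ₜ[k] w)))

/-- The quantum space `k_R[V]`: the tensor algebra on `V` modulo the ideal generated by the elements
`v ⊗ w - R (v ⊗ w)`. -/
abbrev QuantumSpace (R : V ⊗[k] V →ₗ[k] V ⊗[k] V) : Type _ := RingQuot (QuantumRel R)

/-- The canonical map `V → k_R[V]`. -/
noncomputable def QuantumSpace.ι (R : V ⊗[k] V →ₗ[k] V ⊗[k] V) : V →ₗ[k] QuantumSpace R :=
  (RingQuot.mkAlgHom k (QuantumRel R)).toLinearMap ∘ₗ TensorAlgebra.ι k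

end QuantumSpace

/-- The inclusion of `V = kX` in `k[V]`, the polynomial algebra in the variables `x ∈ X`. -/
noncomputable def polyIncl (k : Type v) [Field k] (X : Type u) : (X →₀ k) →ₗ[k] MvPolynomial X k :=
  Finsupp.linearCombination k MvPolynomial.X

/-! Square-freeness and level 2 force `ℒ` to be constant on orbits (`left_left_eq`), and then the
braid relation makes the `ℒ x` commute (`left_comm`). Hence `ℋ` is abelian and, for `x ∈ X_i` and `y
∈ X_j`, `r (x, y) = (γ^i y, (γ^j)⁻¹ x)` (`r_eq`). So `ℋ` permutes the variables, monomials have an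
`ℋ`-valued degree with `x ↦ γ^i`, and the action preserves degrees. Such an action and grading
together are what the coaction of `k(ℋ) ⊗ kℋ` encodes.

The cocycle reads off the degree of the left factor and lets it act on the right one: `x^s • x^t =
x^(s + deg s · t)` (`twMul_monomial`). Associativity and the unit follow by comparing exponents.

Write `d_x` for the degree of `x`. Then `x • d_x⁻¹y = xy = y • d_y⁻¹x`, and these are the relations
defined by `r`. In any algebra whose generators satisfy them, a monomial `x₁⋯xₙ` determines the word
`x₁ · d₁⁻¹x₂ · (d₁d₂)⁻¹x₃ ⋯`, which does not depend on the order of the factors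
(`prod_untwist_perm`). The resulting linear map is multiplicative for `•` (`wordMap_twMul`), and
onto if the generators generate. It is injective if the algebra acts on polynomials by twisted left
multiplications, because a word applied to `1` returns its monomial (`prod_leftMulX`).
`exists_twMul_equiv` packages this, and both presented algebras meet its conditions. -/

/-! ### Comodules from graded group actions -/

section Coaction

open FunctionAlgebra

variable {k : Type v} [Field k] {G : Type u}

theorem FunctionAlgebra.delta_mul_delta (g h : G) [Decidable (g = h)] :
    delta k g * delta k h = if g = h then delta k g else 0 := by
  classical
  ext x
  split_ifs with e
  · subst e
    simp [eval_delta]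
  · simp only [map_mul, eval_delta, map_zero]
    split_ifs with h1 h2 <;> simp_all

theorem FunctionAlgebra.sum_delta [Fintype G] : ∑ g : G, delta k g = 1 := by
  classical
  ext x
  simp [map_sum, eval_delta]

variable [Group G]

theorem FunctionAlgebra.comul_delta [Fintype G] (g : G) :
    Coalgebra.comul (R := k) (delta k g) = ∑ a : G, delta k a ⊗ₜ[k] delta k (a⁻¹ * g) := by
  classical
  refine ext_eval₂ k _ _ fun a b => ?_
  rw [evalTensor_comul]
  simp only [map_sum, evalTensor_tmul, eval_delta, ite_mul, one_mul, zero_mul, Finset.sum_ite_eq,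
    Finset.mem_univ, if_true]
  exact if_congr eq_inv_mul_iff_mul_eq.symm rfl rfl

theorem DoubleAlgebra.comul_delta [Fintype G] (g h : G) :
    Coalgebra.comul (R := k) (delta k g ⊗ₜ[k] MonoidAlgebra.single h (1 : k)) =
      ∑ a : G, (delta k a ⊗ₜ[k] MonoidAlgebra.single h (1 : k)) ⊗ₜ[k]
        (delta k (a⁻¹ * g) ⊗ₜ[k] MonoidAlgebra.single h (1 : k)) := by
  rw [TensorProduct.comul_tmul, FunctionAlgebra.comul_delta]
  simp [TensorProduct.sum_tmul]

/-- The `k(G)` part encodes the action and the `kG` part the grading; invariance of the degree makes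
the two coactions compatible. It serves both for the variables and for the monomials. -/
theorem isRightComodule_of_graded_action [Fintype G] {A Y : Type*} [AddCommMonoid A] [Module k A]
    (b : Module.Basis Y k A) (act : G → Y → Y) (act_one : ∀ y, act 1 y = y)
    (act_mul : ∀ g h y, act (g * h) y = act g (act h y))
    (deg : Y → G) (deg_act : ∀ g y, deg (act g y) = deg y)
    (ρ : A →ₗ[k] A ⊗[k] DoubleAlgebra k G)
    (hρ : ∀ y, ρ (b y) = ∑ g : G, b (act g y) ⊗ₜ[k]
      (delta k g ⊗ₜ[k] MonoidAlgebra.single (deg y) (1 : k))) :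
    IsRightComodule ρ where
  coassoc := by
    refine b.ext fun y => ?_
    simp only [LinearMap.comp_apply, hρ, map_sum, LinearMap.rTensor_tmul, LinearMap.lTensor_tmul,
      DoubleAlgebra.comul_delta, TensorProduct.sum_tmul, TensorProduct.tmul_sum,
      LinearEquiv.coe_coe, TensorProduct.assoc_tmul, deg_act, ← act_mul]
    rw [Finset.sum_comm]
    conv_rhs => rw [Finset.sum_comm]
    refine Finset.sum_congr rfl fun a _ => ?_
    -- In the coproduct of `δ_h` the term starting with `δ_a` is `δ_a ⊗ δ_(a⁻¹h)`; put `h = a c`.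
    refine Fintype.sum_equiv (Equiv.mulLeft a) _ _ fun c => ?_
    simp
  counit := by
    classical
    refine b.ext fun y => ?_
    simp only [LinearMap.comp_apply, hρ, map_sum, LinearMap.lTensor_tmul, LinearEquiv.coe_coe,
      TensorProduct.rid_tmul, TensorProduct.counit_tmul, MonoidAlgebra.counit_single,
      FunctionAlgebra.counit_apply, eval_delta]
    simp [act_one]

end Coaction

/-! ### The canonical 2-cocycle -/

section Cocycle

open FunctionAlgebra

variable {k : Type v} [Field k] {G : Type u} [Group G]

/-- `φ` is evaluation of both function factors at points depending on the group-like factors. -/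
def IsPointForm₂ (φ : DoubleAlgebra k G ⊗[k] DoubleAlgebra k G →ₗ[k] k)
    (α β : G → G → G) : Prop :=
  ∀ f f' g g', φ ((f ⊗ₜ MonoidAlgebra.single g 1) ⊗ₜ (f' ⊗ₜ MonoidAlgebra.single g' 1)) =
    eval k (α g g') f * eval k (β g g') f'

/-- `φ` is evaluation of the three function factors at points depending on the group-like
factors. -/
def IsPointForm₃ (φ : DoubleAlgebra k G ⊗[k] (DoubleAlgebra k G ⊗[k] DoubleAlgebra k G) →ₗ[k] k)
    (α β γ : G → G → G → G) : Prop :=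
  ∀ f f' f'' g g' g'', φ ((f ⊗ₜ MonoidAlgebra.single g 1) ⊗ₜ
      ((f' ⊗ₜ MonoidAlgebra.single g' 1) ⊗ₜ (f'' ⊗ₜ MonoidAlgebra.single g'' 1))) =
    eval k (α g g' g'') f * (eval k (β g g' g'') f' * eval k (γ g g' g'') f'')

theorem IsPointForm₂.ext {φ ψ : DoubleAlgebra k G ⊗[k] DoubleAlgebra k G →ₗ[k] k}
    {α β : G → G → G} (hφ : IsPointForm₂ φ α β) (hψ : IsPointForm₂ ψ α β) : φ = ψ := by
  ext f g f' g'
  exact (hφ f f' g g').trans (hψ f f' g g').symm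

theorem IsPointForm₃.ext
    {φ ψ : DoubleAlgebra k G ⊗[k] (DoubleAlgebra k G ⊗[k] DoubleAlgebra k G) →ₗ[k] k}
    {α β γ : G → G → G → G} (hφ : IsPointForm₃ φ α β γ) (hψ : IsPointForm₃ ψ α β γ) : φ = ψ := by
  ext f g f' g' f'' g''
  exact (hφ f f' f'' g g' g'').trans (hψ f f' f'' g g' g'').symm

variable [Finite G]

theorem FunctionAlgebra.exists_repr (f : FunctionAlgebra k G) :
    ∃ (s : Finset (G × G)) (l r : G × G → FunctionAlgebra k G),
      Coalgebra.comul (R := k) f = ∑ i ∈ s, l i ⊗ₜ[k] r i ∧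
      ∀ a b, ∑ i ∈ s, eval k a (l i) * eval k b (r i) = eval k (a * b) f := by
  have := Fintype.ofFinite G
  have h : Coalgebra.comul (R := k) f =
      ∑ i : G × G, (eval k (i.1 * i.2) f • delta k i.1) ⊗ₜ[k] delta k i.2 := by
    classical
    refine ext_eval₂ k _ _ fun a b => ?_
    rw [evalTensor_comul]
    simp [map_sum, evalTensor_tmul, eval_delta, Fintype.sum_prod_type]
  refine ⟨_, _, _, h, fun a b => ?_⟩
  rw [← evalTensor_comul, h, map_sum]
  simp only [evalTensor_tmul]

/-- The element `g` is group-like, so only `f` is split. Later computations see the pieces of `f`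
only through their values, hence the second clause. -/
theorem DoubleAlgebra.exists_repr (f : FunctionAlgebra k G) (g : G) :
    ∃ (s : Finset (G × G)) (l r : G × G → FunctionAlgebra k G),
      Coalgebra.comul (R := k) (f ⊗ₜ[k] MonoidAlgebra.single g (1 : k)) =
        ∑ i ∈ s, (l i ⊗ₜ[k] MonoidAlgebra.single g (1 : k)) ⊗ₜ[k]
          (r i ⊗ₜ[k] MonoidAlgebra.single g (1 : k)) ∧
      ∀ a b, ∑ i ∈ s, eval k a (l i) * eval k b (r i) = eval k (a * b) f := by
  obtain ⟨s, l, r, h, h'⟩ := FunctionAlgebra.exists_repr f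
  refine ⟨s, l, r, ?_, h'⟩
  rw [TensorProduct.comul_tmul, h]
  simp [TensorProduct.sum_tmul]

/-- Evaluation at `a` convolved with evaluation at `b` is evaluation at `a b`, while the group-like
factors are merely duplicated. Convolution identities thus become identities between points of `G`.
-/
theorem IsPointForm₂.convMul {φ ψ : DoubleAlgebra k G ⊗[k] DoubleAlgebra k G →ₗ[k] k}
    {α β α' β' : G → G → G} (hφ : IsPointForm₂ φ α β) (hψ : IsPointForm₂ ψ α' β') :
    IsPointForm₂ (WithConv.toConv φ * WithConv.toConv ψ).ofConv
       (fun g g' => α g g' * α' g g') (fun g g' => β g g' * β' g g') := by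
  intro f f' g g'
  obtain ⟨s, l, r, h, hs⟩ := DoubleAlgebra.exists_repr f g
  obtain ⟨s', l', r', h', hs'⟩ := DoubleAlgebra.exists_repr f' g'
  change (WithConv.toConv φ * WithConv.toConv ψ) _ = _
  rw [LinearMap.convMul_apply, TensorProduct.comul_tmul, h, h', ← hs, ← hs', Finset.sum_mul_sum]
  simp only [TensorProduct.sum_tmul, TensorProduct.tmul_sum, map_sum,
    TensorProduct.AlgebraTensorModule.tensorTensorTensorComm_tmul, TensorProduct.map_tmul,
    LinearMap.mul'_apply]
  rw [Finset.sum_comm]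
  refine Finset.sum_congr rfl fun i _ => Finset.sum_congr rfl fun j _ => ?_
  rw [hφ, hψ]
  ring

theorem IsPointForm₃.convMul
    {φ ψ : DoubleAlgebra k G ⊗[k] (DoubleAlgebra k G ⊗[k] DoubleAlgebra k G) →ₗ[k] k}
    {α β γ α' β' γ' : G → G → G → G} (hφ : IsPointForm₃ φ α β γ)
    (hψ : IsPointForm₃ ψ α' β' γ') :
    IsPointForm₃ (WithConv.toConv φ * WithConv.toConv ψ).ofConv
      (fun g g' g'' => α g g' g'' * α' g g' g'')
      (fun g g' g'' => β g g' g'' * β' g g' g'') (fun g g' g'' => γ g g' g'' * γ' g g' g'') := by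
  intro f f' f'' g g' g''
  obtain ⟨s, l, r, h, hs⟩ := DoubleAlgebra.exists_repr f g
  obtain ⟨s', l', r', h', hs'⟩ := DoubleAlgebra.exists_repr f' g'
  obtain ⟨s'', l'', r'', h'', hs''⟩ := DoubleAlgebra.exists_repr f'' g''
  change (WithConv.toConv φ * WithConv.toConv ψ) _ = _
  rw [LinearMap.convMul_apply, TensorProduct.comul_tmul, h, TensorProduct.comul_tmul, h', h'',
    ← hs, ← hs', ← hs'', Finset.sum_mul_sum s', Finset.sum_mul_sum]
  simp only [TensorProduct.sum_tmul, TensorProduct.tmul_sum, map_sum,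
    TensorProduct.AlgebraTensorModule.tensorTensorTensorComm_tmul, TensorProduct.map_tmul,
    LinearMap.mul'_apply]
  simp only [Finset.mul_sum]
  rw [Finset.sum_comm_cycle]
  refine Finset.sum_congr rfl fun i _ => ?_
  rw [Finset.sum_comm]
  refine Finset.sum_congr rfl fun j _ => Finset.sum_congr rfl fun m _ => ?_
  rw [hφ, hψ]
  ring

theorem IsPointForm₂.canonicalCocycle :
    IsPointForm₂ (canonicalCocycle k G) (fun _ _ => 1) (fun g _ => g) :=
  fun f f' g g' => canonicalCocycle_apply k G f f' g g'

theorem IsPointForm₂.convOne :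
    IsPointForm₂ (1 : WithConv (DoubleAlgebra k G ⊗[k] DoubleAlgebra k G →ₗ[k] k)).ofConv
      (fun _ _ => 1) (fun _ _ => 1) := by
  intro f f' g g'
  change (1 : WithConv (DoubleAlgebra k G ⊗[k] DoubleAlgebra k G →ₗ[k] k)) _ = _
  simp [LinearMap.convOne_apply, FunctionAlgebra.counit_apply, mul_comm]

/-- The convolution inverse `(f ⊗ h) ⊗ (f' ⊗ h') ↦ ε(f) ε(h') f'(h⁻¹)` of the canonical map. -/
noncomputable def canonicalCocycleInv (k : Type v) [Field k] (G : Type u) [Group G] [Finite G] :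
    DoubleAlgebra k G ⊗[k] DoubleAlgebra k G →ₗ[k] k :=
  canonicalCocycle k G ∘ₗ
    ((comap k (fun g : G => g⁻¹)).toLinearMap.rTensor (MonoidAlgebra k G)).lTensor _

theorem IsPointForm₂.canonicalCocycleInv :
    IsPointForm₂ (canonicalCocycleInv k G) (fun _ _ => 1) (fun g _ => g⁻¹) := by
  intro f f' g g'
  simp only [_root_.canonicalCocycleInv, LinearMap.comp_apply, LinearMap.lTensor_tmul,
    LinearMap.rTensor_tmul, canonicalCocycle_apply, AlgHom.toLinearMap_apply, eval_comap]

/-- Both sides of the cocycle identity evaluate the three functions at points of `G`. The points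
agree except the last, which is `g g'` on one side and `g' g` on the other; this is where
commutativity enters. -/
theorem isHopfTwoCocycle_canonicalCocycle (hG : ∀ a b : G, a * b = b * a) :
    IsHopfTwoCocycle (canonicalCocycle k G) where
  isUnit := by
    refine isUnit_iff_exists.2 ⟨WithConv.toConv (canonicalCocycleInv k G), ?_, ?_⟩ <;>
    refine WithConv.ofConv_injective (IsPointForm₂.ext ?_ IsPointForm₂.convOne)
    · have h := IsPointForm₂.convMul (k := k) (G := G)
        IsPointForm₂.canonicalCocycle IsPointForm₂.canonicalCocycleInv
      simpa only [mul_one, mul_inv_cancel] using h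
    · have h := IsPointForm₂.convMul (k := k) (G := G)
        IsPointForm₂.canonicalCocycleInv IsPointForm₂.canonicalCocycle
      simpa only [mul_one, inv_mul_cancel] using h
  one_left := by
    have h : canonicalCocycle k G ∘ₗ TensorProduct.mk k _ _ 1 =
        Coalgebra.counit (R := k) (A := DoubleAlgebra k G) := by
      ext f g
      change canonicalCocycle k G
        ((1 ⊗ₜ MonoidAlgebra.single 1 1) ⊗ₜ (f ⊗ₜ MonoidAlgebra.single g 1)) =
        Coalgebra.counit (R := k) (A := DoubleAlgebra k G) (f ⊗ₜ MonoidAlgebra.single g 1)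
      rw [canonicalCocycle_apply]
      simp [FunctionAlgebra.counit_apply]
    exact fun a => LinearMap.congr_fun h a
  one_right := by
    have h : canonicalCocycle k G ∘ₗ (TensorProduct.mk k _ _).flip 1 =
        Coalgebra.counit (R := k) (A := DoubleAlgebra k G) := by
      ext f g
      change canonicalCocycle k G
        ((f ⊗ₜ MonoidAlgebra.single g 1) ⊗ₜ (1 ⊗ₜ MonoidAlgebra.single 1 1)) =
        Coalgebra.counit (R := k) (A := DoubleAlgebra k G) (f ⊗ₜ MonoidAlgebra.single g 1)
      rw [canonicalCocycle_apply]
      simp [FunctionAlgebra.counit_apply]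
    exact fun a => LinearMap.congr_fun h a
  cocycle := by
    intro ε m F₁₂ F₂₃
    have h₁₂ : IsPointForm₃ F₁₂ (fun _ _ _ => (1 : G)) (fun g _ _ => g) (fun _ _ _ => 1) := by
      intro f f' f'' g g' g''
      simp [F₁₂, ε, canonicalCocycle_apply, FunctionAlgebra.counit_apply, mul_assoc]
    have h₂₃ : IsPointForm₃ F₂₃ (fun _ _ _ => (1 : G)) (fun _ _ _ => 1) (fun _ g _ => g) := by
      intro f f' f'' g g' g''
      simp [F₂₃, ε, canonicalCocycle_apply, FunctionAlgebra.counit_apply]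
    have hl : IsPointForm₃ (canonicalCocycle k G ∘ₗ m.rTensor _ ∘ₗ
        (TensorProduct.assoc k _ _ _).symm.toLinearMap)
        (fun _ _ _ => (1 : G)) (fun _ _ _ => 1) (fun g g' _ => g * g') := by
      intro f f' f'' g g' g''
      simp [m, canonicalCocycle_apply, mul_assoc]
    have hr : IsPointForm₃ (canonicalCocycle k G ∘ₗ m.lTensor _)
        (fun _ _ _ => (1 : G)) (fun g _ _ => g) (fun g _ _ => g) := by
      intro f f' f'' g g' g''
      simp [m, canonicalCocycle_apply]
    have e₁ := IsPointForm₃.convMul h₁₂ hl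
    have e₂ := IsPointForm₃.convMul h₂₃ hr
    simp only [one_mul, mul_one] at e₁ e₂
    refine WithConv.ofConv_injective (IsPointForm₃.ext e₁ ?_)
    simpa only [hG] using e₂

end Cocycle

theorem sum_mul_sum_of_orthogonal {R ι : Type*} [Semiring R] [Fintype ι] [DecidableEq ι]
    (a b c : ι → R) (h : ∀ i j, a i * b j = if i = j then c i else 0) :
    (∑ i, a i) * ∑ j, b j = ∑ i, c i := by
  simp [Finset.sum_mul_sum, h]

theorem cotwistMul_of_sum {k : Type*} [CommRing k] {A H ι κ : Type*} [Ring A] [Algebra k A]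
    [AddCommGroup H] [Module k H] [Fintype ι] [Fintype κ] (ρ : A →ₗ[k] A ⊗[k] H)
    (F : H ⊗[k] H →ₗ[k] k) {f g : A} {a : ι → A} {u : ι → H} {b : κ → A} {w : κ → H}
    (hf : ρ f = ∑ i, a i ⊗ₜ u i) (hg : ρ g = ∑ j, b j ⊗ₜ w j) :
    cotwistMul ρ F f g = ∑ i, ∑ j, F (u i ⊗ₜ w j) • (a i * b j) := by
  simp only [cotwistMul, TensorProduct.curry_apply, LinearMap.comp_apply, TensorProduct.map_tmul,
    hf, hg, TensorProduct.sum_tmul, TensorProduct.tmul_sum, map_sum, LinearEquiv.coe_coe,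
    TensorProduct.tensorTensorTensorComm_tmul, LinearMap.mul'_apply, TensorProduct.rid_tmul]
  exact Finset.sum_comm

/-! ### Polynomials twisted by an invariant degree -/

section TwistedPolynomials

open FunctionAlgebra MvPolynomial

variable {k : Type v} [Field k] {G : Type u} [Group G] {X : Type u} [MulAction G X]

/-- The action of `g` on exponent vectors. -/
noncomputable def expAct (g : G) (s : X →₀ ℕ) : X →₀ ℕ := s.mapDomain (g • ·)

theorem expAct_single (g : G) (x : X) (n : ℕ) :
    expAct g (Finsupp.single x n) = Finsupp.single (g • x) n := Finsupp.mapDomain_single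

theorem expAct_add (g : G) (s t : X →₀ ℕ) : expAct g (s + t) = expAct g s + expAct g t :=
  Finsupp.mapDomain_add

theorem expAct_zero (g : G) : expAct g (0 : X →₀ ℕ) = 0 := Finsupp.mapDomain_zero

theorem one_expAct (s : X →₀ ℕ) : expAct (1 : G) s = s := by
  simp only [expAct, one_smul]
  exact Finsupp.mapDomain_id

theorem mul_expAct (g h : G) (s : X →₀ ℕ) : expAct (g * h) s = expAct g (expAct h s) := by
  rw [expAct, expAct, expAct, ← Finsupp.mapDomain_comp]
  simp only [Function.comp_def, mul_smul]

/-- A `G`-valued degree function on monomials that is invariant under the action of `G`. -/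
structure InvariantDegree (G X : Type u) [Group G] [MulAction G X] where
  /-- the degree, as a monoid homomorphism -/
  hom : Multiplicative (X →₀ ℕ) →* G
  hom_smul : ∀ (g : G) (x : X), hom (.ofAdd (.single (g • x) 1)) = hom (.ofAdd (.single x 1))

namespace InvariantDegree

variable (D : InvariantDegree G X)

/-- The degree of an exponent vector. -/
noncomputable def deg (s : X →₀ ℕ) : G := D.hom (.ofAdd s)

/-- The degree of a variable. -/
noncomputable def degX (x : X) : G := D.deg (.single x 1)

theorem deg_zero : D.deg 0 = 1 := D.hom.map_one

theorem deg_add (s t : X →₀ ℕ) : D.deg (s + t) = D.deg s * D.deg t := D.hom.map_mul _ _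

/-- Degrees commute with each other even if `G` is not abelian, because addition of exponents is
commutative. -/
theorem deg_comm (s t : X →₀ ℕ) : D.deg s * D.deg t = D.deg t * D.deg s := by
  rw [← deg_add, ← deg_add, add_comm]

theorem degX_smul (g : G) (x : X) : D.degX (g • x) = D.degX x := D.hom_smul g x

theorem deg_expAct (g : G) (s : X →₀ ℕ) : D.deg (expAct g s) = D.deg s := by
  induction s using Finsupp.induction_linear with
  | zero => rw [expAct_zero]
  | add s t hs ht => rw [expAct_add, deg_add, deg_add, hs, ht]
  | single x n =>
    rw [expAct_single]
    induction n with
    | zero => simp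
    | succ n ih =>
      rw [Finsupp.single_add, Finsupp.single_add, deg_add, deg_add, ih]
      exact congrArg _ (D.degX_smul g x)

section Coaction

variable [Fintype G]

/-- The coaction `x^s ↦ ∑ g, x^(g s) ⊗ (δ_g ⊗ deg s)` on monomials. -/
noncomputable def monomialCoaction (k : Type v) [Field k] :
    Multiplicative (X →₀ ℕ) →* MvPolynomial X k ⊗[k] DoubleAlgebra k G where
  toFun s := ∑ g : G, monomial (expAct g s.toAdd) (1 : k) ⊗ₜ[k]
    (delta k g ⊗ₜ[k] MonoidAlgebra.single (D.deg s.toAdd) (1 : k))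
  map_one' := by
    simp only [toAdd_one, expAct_zero, deg_zero, ← TensorProduct.tmul_sum,
      ← TensorProduct.sum_tmul, sum_delta]
    rfl
  map_mul' s t := by
    classical
    -- The `δ_g` are orthogonal idempotents, so only the diagonal of the double sum survives.
    refine (sum_mul_sum_of_orthogonal (ι := G)
      (R := MvPolynomial X k ⊗[k] DoubleAlgebra k G) _ _ _ fun g h => ?_).symm
    rw [Algebra.TensorProduct.tmul_mul_tmul, Algebra.TensorProduct.tmul_mul_tmul, monomial_mul,
      delta_mul_delta, MonoidAlgebra.single_mul_single, toAdd_mul, expAct_add, deg_add, mul_one]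
    split_ifs with e
    · rw [e]
    · rw [TensorProduct.zero_tmul, TensorProduct.tmul_zero]

/-- The coaction on polynomials that extends `monomialCoaction`. -/
noncomputable def polyCoaction (k : Type v) [Field k] :
    MvPolynomial X k →ₐ[k] MvPolynomial X k ⊗[k] DoubleAlgebra k G :=
  AddMonoidAlgebra.lift k _ _ (D.monomialCoaction k)

theorem polyCoaction_monomial (s : X →₀ ℕ) (a : k) : D.polyCoaction k (monomial s a) =
    a • ∑ g : G, monomial (expAct g s) (1 : k) ⊗ₜ[k]
      (delta k g ⊗ₜ[k] MonoidAlgebra.single (D.deg s) (1 : k)) :=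
  AddMonoidAlgebra.lift_single _ _ _

theorem isRightComodule_polyCoaction : IsRightComodule (D.polyCoaction k).toLinearMap :=
  isRightComodule_of_graded_action (basisMonomials X k) expAct one_expAct mul_expAct D.deg
    D.deg_expAct _ fun s => by
      simp only [coe_basisMonomials, AlgHom.toLinearMap_apply, polyCoaction_monomial, one_smul]

/-- The cotwisted product on polynomials. -/
noncomputable abbrev twMul (k : Type v) [Field k] :
    MvPolynomial X k →ₗ[k] MvPolynomial X k →ₗ[k] MvPolynomial X k :=
  cotwistMul (D.polyCoaction k).toLinearMap (canonicalCocycle k G)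

/-- In the double sum over `G × G` the cocycle takes `δ_g` at `1` and `δ_g'` at `deg s`, leaving the
single term `g = 1`, `g' = deg s`. -/
theorem twMul_monomial (s t : X →₀ ℕ) (a b : k) :
    D.twMul k (monomial s a) (monomial t b) = monomial (s + expAct (D.deg s) t) (a * b) := by
  classical
  rw [← mul_one a, ← smul_eq_mul, ← smul_monomial, ← mul_one b, ← smul_eq_mul, ← smul_monomial,
    map_smul, map_smul, LinearMap.smul_apply]
  have h (s : X →₀ ℕ) := D.polyCoaction_monomial (k := k) s 1
  simp only [one_smul] at h
  rw [twMul, cotwistMul_of_sum _ _ (h s) (h t), Finset.sum_eq_single 1,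
    Finset.sum_eq_single (D.deg s)]
  · simp [canonicalCocycle_apply, eval_delta, one_expAct, smul_monomial, mul_comm a b]
  · intro g _ hg
    simp [canonicalCocycle_apply, eval_delta, hg.symm]
  · simp
  · intro g _ hg
    simp [canonicalCocycle_apply, eval_delta, hg.symm]
  · simp

/-- On monomials both bracketings have exponent `s + deg s · t + (deg s * deg t) · w`, since acting
on `t` does not change its degree. -/
theorem twMul_assoc (f g h : MvPolynomial X k) :
    D.twMul k (D.twMul k f g) h = D.twMul k f (D.twMul k g h) := by
  induction f using MvPolynomial.induction_on' with
  | add p q hp hq => simp only [map_add, LinearMap.add_apply, hp, hq]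
  | monomial s a =>
    induction g using MvPolynomial.induction_on' with
    | add p q hp hq => simp only [map_add, LinearMap.add_apply, hp, hq]
    | monomial t b =>
      induction h using MvPolynomial.induction_on' with
      | add p q hp hq => simp only [map_add, hp, hq]
      | monomial w c =>
        simp only [twMul_monomial, deg_add, deg_expAct, expAct_add, mul_expAct, add_assoc,
          mul_assoc]

theorem one_twMul (f : MvPolynomial X k) : D.twMul k 1 f = f := by
  induction f using MvPolynomial.induction_on' with
  | add p q hp hq => simp only [map_add, hp, hq]
  | monomial s a => rw [one_def, twMul_monomial, deg_zero, one_expAct, zero_add, one_mul]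

theorem twMul_one (f : MvPolynomial X k) : D.twMul k f 1 = f := by
  induction f using MvPolynomial.induction_on' with
  | add p q hp hq => simp only [map_add, LinearMap.add_apply, hp, hq]
  | monomial s a => rw [one_def, twMul_monomial, expAct_zero, add_zero, mul_one]

theorem twMul_X_X (x y : X) : D.twMul k (.X x) (.X y) = .X x * .X (D.degX x • y) := by
  simp only [MvPolynomial.X, twMul_monomial, expAct_single, monomial_mul]
  rfl

end Coaction

end InvariantDegree

end TwistedPolynomials

/-! ### Untwisted words and a criterion for isomorphism -/

section Untwist

variable {G : Type u} [Group G] {X : Type u} [MulAction G X]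

/-- The exponent vector of a list of variables. -/
noncomputable def listExp (l : List X) : X →₀ ℕ := (l.map (Finsupp.single · 1)).sum

theorem toMultiset_listExp (l : List X) : Finsupp.toMultiset (listExp l) = l := by
  induction l with
  | nil => simp [listExp]
  | cons x l ih =>
    simp only [listExp, List.map_cons, List.sum_cons, map_add] at ih ⊢
    rw [ih]
    simp

theorem listExp_append (l l' : List X) : listExp (l ++ l') = listExp l + listExp l' := by
  simp [listExp]

theorem listExp_toList (s : X →₀ ℕ) : listExp (Finsupp.toMultiset s).toList = s := by
  classical
  rw [← Finsupp.toMultiset_toFinsupp (listExp _), toMultiset_listExp, Multiset.coe_toList,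
    Finsupp.toMultiset_toFinsupp]

theorem listExp_map (g : G) (l : List X) : listExp (l.map (g • ·)) = expAct g (listExp l) := by
  induction l with
  | nil => exact (expAct_zero g).symm
  | cons x l ih =>
    simp only [listExp, List.map_cons, List.sum_cons, expAct_add, expAct_single] at ih ⊢
    rw [ih]

namespace InvariantDegree

variable (D : InvariantDegree G X)

/-- The word `g⁻¹ x₁, (g d₁)⁻¹ x₂, (g d₁ d₂)⁻¹ x₃, …`, where `dᵢ` is the degree of `xᵢ`. -/
noncomputable def untwist : G → List X → List X
  | _, [] => []
  | g, x :: l => (g⁻¹ • x) :: untwist (g * D.degX x) l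

theorem untwist_append (g : G) (l l' : List X) :
    D.untwist g (l ++ l') = D.untwist g l ++ D.untwist (g * D.deg (listExp l)) l' := by
  induction l generalizing g with
  | nil => simp [untwist, listExp, deg_zero]
  | cons x l ih =>
    have h : D.deg (listExp (x :: l)) = D.degX x * D.deg (listExp l) := D.deg_add _ _
    rw [h, List.cons_append, untwist, untwist, ih, List.cons_append, mul_assoc]

/-- Each letter is moved by `h` and each prefix gains `h` on the left, so the two cancel; degrees do
not see the action. -/
theorem untwist_mul_map (g h : G) (l : List X) :
    D.untwist (h * g) (l.map (h • ·)) = D.untwist g l := by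
  induction l generalizing g with
  | nil => rfl
  | cons x l ih =>
    rw [List.map_cons, untwist, untwist, degX_smul, mul_assoc, ih, smul_smul, mul_inv_rev,
      inv_mul_cancel_right]

section Monoid

variable {M : Type*} [Monoid M] (gen : X → M)

/-- `gen` satisfies the defining relations of the Yang–Baxter algebra. -/
def Respects : Prop :=
  ∀ x y, gen x * gen ((D.degX x)⁻¹ • y) = gen y * gen ((D.degX y)⁻¹ • x)

variable {D gen}

/-- It suffices to swap two leading letters. The relation exchanges them, and the rest of the word
is unchanged because the prefix degrees commute. -/
theorem prod_untwist_perm (hgen : D.Respects gen) {l l' : List X} (h : l.Perm l') (g : G) :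
    ((D.untwist g l).map gen).prod = ((D.untwist g l').map gen).prod := by
  induction h generalizing g with
  | nil => rfl
  | cons x _ ih => simp only [untwist, List.map_cons, List.prod_cons, ih]
  | swap x y l =>
    have h := hgen (g⁻¹ • y) (g⁻¹ • x)
    have hc : D.degX y * D.degX x = D.degX x * D.degX y := D.deg_comm _ _
    simp only [degX_smul, smul_smul] at h
    simp only [untwist, List.map_cons, List.prod_cons, mul_inv_rev, ← mul_assoc, h]
    simp only [mul_assoc, hc]
  | trans _ _ ih₁ ih₂ => rw [ih₁, ih₂]

variable (D gen) in
/-- The value of the word attached to an exponent vector. -/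
noncomputable def wordOf (s : X →₀ ℕ) : M :=
  ((D.untwist 1 (Finsupp.toMultiset s).toList).map gen).prod

/-- The enumeration chosen by `toList` may be replaced by any other. -/
theorem wordOf_listExp (hgen : D.Respects gen) (l : List X) :
    D.wordOf gen (listExp l) = ((D.untwist 1 l).map gen).prod := by
  refine prod_untwist_perm hgen (Multiset.coe_eq_coe.1 ?_) 1
  rw [Multiset.coe_toList, toMultiset_listExp]

theorem wordOf_single (hgen : D.Respects gen) (x : X) : D.wordOf gen (.single x 1) = gen x := by
  have h := wordOf_listExp hgen [x]
  simpa [listExp, untwist] using h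

theorem wordOf_zero (hgen : D.Respects gen) : D.wordOf gen 0 = 1 := by
  have h := wordOf_listExp hgen []
  simpa [listExp, untwist] using h

/-- Concatenate an enumeration of `s` with one of `t` moved by `deg s`: untwisting the second part
starts at `deg s` and cancels that move. -/
theorem wordOf_add (hgen : D.Respects gen) (s t : X →₀ ℕ) :
    D.wordOf gen (s + expAct (D.deg s) t) = D.wordOf gen s * D.wordOf gen t := by
  rw [← listExp_toList s, ← listExp_toList t]
  generalize (Finsupp.toMultiset s).toList = l
  generalize (Finsupp.toMultiset t).toList = l'
  have h := D.untwist_mul_map 1 (D.deg (listExp l)) l'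
  rw [mul_one] at h
  rw [← listExp_map, ← listExp_append, wordOf_listExp hgen, wordOf_listExp hgen,
    wordOf_listExp hgen, untwist_append, one_mul, h, List.map_append, List.prod_append]

end Monoid

section Algebra

open MvPolynomial

/-- The linear map from polynomials that sends a monomial to its word. -/
noncomputable def wordMap {B : Type*} [Ring B] (gen : X → B) (k : Type v) [Field k] [Algebra k B] :
    MvPolynomial X k →ₗ[k] B :=
  (basisMonomials X k).constr k (D.wordOf gen)

variable {D} {k : Type v} [Field k] {B : Type*} [Ring B] [Algebra k B] {gen : X → B}

theorem wordMap_monomial (s : X →₀ ℕ) (a : k) :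
    D.wordMap gen k (monomial s a) = a • D.wordOf gen s := by
  rw [← mul_one a, ← smul_eq_mul, ← smul_monomial, map_smul, wordMap, smul_eq_mul, mul_one]
  exact congrArg _ ((basisMonomials X k).constr_basis k (D.wordOf gen) s)

theorem wordMap_X (hgen : D.Respects gen) (x : X) : D.wordMap gen k (.X x) = gen x := by
  rw [MvPolynomial.X, wordMap_monomial, one_smul, wordOf_single hgen]

theorem wordMap_one (hgen : D.Respects gen) : D.wordMap gen k 1 = 1 := by
  rw [MvPolynomial.one_def, wordMap_monomial, one_smul, wordOf_zero hgen]

variable [Fintype G]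

theorem wordMap_twMul (hgen : D.Respects gen) (f g : MvPolynomial X k) :
    D.wordMap gen k (D.twMul k f g) = D.wordMap gen k f * D.wordMap gen k g := by
  induction f using MvPolynomial.induction_on' with
  | add p q hp hq => simp only [map_add, LinearMap.add_apply, hp, hq, add_mul]
  | monomial s a =>
    induction g using MvPolynomial.induction_on' with
    | add p q hp hq => simp only [map_add, hp, hq, mul_add]
    | monomial t b =>
      rw [twMul_monomial, wordMap_monomial, wordMap_monomial, wordMap_monomial, wordOf_add hgen,
        smul_mul_smul_comm]

theorem wordMap_surjective (hgen : D.Respects gen) (htop : Algebra.adjoin k (Set.range gen) = ⊤) :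
    Function.Surjective (D.wordMap gen k) := by
  intro b
  have hb : b ∈ Algebra.adjoin k (Set.range gen) := htop ▸ Algebra.mem_top
  induction hb using Algebra.adjoin_induction with
  | mem b hb =>
    obtain ⟨x, rfl⟩ := hb
    exact ⟨_, wordMap_X hgen x⟩
  | algebraMap c =>
    exact ⟨c • 1, by rw [map_smul, wordMap_one hgen, Algebra.algebraMap_eq_smul_one]⟩
  | add a b _ _ ha hb =>
    obtain ⟨f, rfl⟩ := ha
    obtain ⟨g, rfl⟩ := hb
    exact ⟨f + g, map_add _ _ _⟩
  | mul a b _ _ ha hb =>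
    obtain ⟨f, rfl⟩ := ha
    obtain ⟨g, rfl⟩ := hb
    exact ⟨D.twMul k f g, wordMap_twMul hgen f g⟩

/-- Left multiplication by `x` for the cotwisted product. -/
noncomputable def leftMulX (D : InvariantDegree G X) (k : Type v) [Field k] (x : X) :
    Module.End k (MvPolynomial X k) := D.twMul k (.X x)

/-- By associativity both sides are twisted left multiplication by the commutative product of `x`
and `y`. -/
theorem respects_leftMulX : D.Respects (D.leftMulX k) := by
  intro x y
  refine LinearMap.ext fun f => ?_
  simp only [leftMulX, Module.End.mul_apply, ← twMul_assoc, twMul_X_X, smul_inv_smul]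
  rw [mul_comm]

theorem prod_leftMulX (g : G) (l : List X) :
    ((D.untwist g l).map (D.leftMulX k)).prod 1 = monomial (expAct g⁻¹ (listExp l)) 1 := by
  induction l generalizing g with
  | nil =>
    simp only [untwist, listExp, List.map_nil, List.prod_nil, List.sum_nil, expAct_zero]
    rfl
  | cons x l ih =>
    have h : D.deg (.single (g⁻¹ • x) 1) = D.degX x := D.degX_smul _ x
    have h' : listExp (x :: l) = .single x 1 + listExp l := rfl
    rw [untwist, List.map_cons, List.prod_cons, Module.End.mul_apply, ih, leftMulX, MvPolynomial.X,
      twMul_monomial, h, ← mul_expAct, mul_inv_rev, mul_inv_cancel_left, h', expAct_add,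
      expAct_single, one_mul]

/-- The map `b ↦ ρ b 1` is a left inverse: it turns each word back into its monomial. -/
theorem wordMap_injective (ρ : B →ₐ[k] Module.End k (MvPolynomial X k))
    (hρ : ∀ x, ρ (gen x) = D.leftMulX k x) : Function.Injective (D.wordMap gen k) := by
  refine Function.LeftInverse.injective (g := fun b => ρ b 1) fun f => ?_
  induction f using MvPolynomial.induction_on' with
  | add p q hp hq => simp only [map_add, LinearMap.add_apply, hp, hq]
  | monomial s a =>
    have h := D.prod_leftMulX (k := k) 1 (Finsupp.toMultiset s).toList
    rw [listExp_toList, inv_one, one_expAct] at h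
    have h' : ρ (D.wordOf gen s) =
        ((D.untwist 1 (Finsupp.toMultiset s).toList).map (D.leftMulX k)).prod := by
      rw [wordOf, map_list_prod, List.map_map]
      exact congrArg (fun F => (List.map F _).prod) (funext hρ)
    beta_reduce
    rw [wordMap_monomial, map_smul, LinearMap.smul_apply, h', h, smul_monomial, smul_eq_mul,
      mul_one]

theorem exists_twMul_equiv (hgen : D.Respects gen)
    (htop : Algebra.adjoin k (Set.range gen) = ⊤)
    (ρ : B →ₐ[k] Module.End k (MvPolynomial X k)) (hρ : ∀ x, ρ (gen x) = D.leftMulX k x) :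
    ∃ Φ : B ≃ₗ[k] MvPolynomial X k, Φ 1 = 1 ∧ (∀ a b, Φ (a * b) = D.twMul k (Φ a) (Φ b)) ∧
      ∀ x, Φ (gen x) = .X x := by
  let Θ := LinearEquiv.ofBijective (D.wordMap gen k)
    ⟨wordMap_injective ρ hρ, wordMap_surjective hgen htop⟩
  have hΘ (f) : Θ f = D.wordMap gen k f := rfl
  refine ⟨Θ.symm, ?_, fun a b => ?_, fun x => ?_⟩ <;> rw [LinearEquiv.symm_apply_eq, hΘ]
  · rw [wordMap_one hgen]
  · rw [wordMap_twMul hgen, ← hΘ, ← hΘ, LinearEquiv.apply_symm_apply, LinearEquiv.apply_symm_apply]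
  · rw [wordMap_X hgen]

end Algebra

end InvariantDegree

end Untwist

/-- The invariant degree determined by invariant degrees of the variables in a commutative group. -/
noncomputable def InvariantDegree.ofComm {G X : Type u} [Group G] [MulAction G X]
    (hG : ∀ a b : G, a * b = b * a) (d : X → G) (hd : ∀ (g : G) x, d (g • x) = d x) :
    InvariantDegree G X :=
  letI : CommGroup G := { (inferInstance : Group G) with mul_comm := hG }
  { hom :=
      { toFun := fun s => s.toAdd.prod fun x n => d x ^ n
        map_one' := Finsupp.prod_zero_index
        map_mul' := fun _ _ => Finsupp.prod_add_index' (fun _ => pow_zero _)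
          fun _ _ _ => pow_add _ _ _ }
    hom_smul := fun g x => by simp [hd] }

theorem InvariantDegree.degX_ofComm {G X : Type u} [Group G] [MulAction G X]
    (hG : ∀ a b : G, a * b = b * a) (d : X → G) (hd : ∀ (g : G) x, d (g • x) = d x) (x : X) :
    (ofComm hG d hd).degX x = d x := by
  let _ : CommGroup G := { (inferInstance : Group G) with mul_comm := hG }
  change (Finsupp.single x 1).prod (fun x n => d x ^ n) = d x
  simp

/-! ### Structure of square-free solutions of level 2 -/

namespace SquareFreeSymmetricSet

variable {X : Type u} (S : SquareFreeSymmetricSet X)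

/-- The action of `ℋ` on `X`: its `i`-th component acts on `X_i`. -/
noncomputable abbrev prodAction : MulAction S.ProdGroup X where
  smul h x := ((h (S.orbitOf x)).1 ⟨x, rfl⟩ : S.Orbit (S.orbitOf x))
  one_smul _ := rfl
  mul_smul g h x := by
    -- The orbit index of a moved point equals the old one only propositionally, so the index is
    -- generalized before being substituted.
    have key : ∀ i (y : S.Orbit i), (((g i).1 y : S.Orbit i) : X) =
        ((g (S.orbitOf (y : X))).1 ⟨y, rfl⟩ : S.Orbit (S.orbitOf (y : X))) := by
      rintro _ ⟨y, rfl⟩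
      rfl
    exact key _ ((h (S.orbitOf x)).1 ⟨x, rfl⟩)

attribute [local instance] prodAction

theorem smul_eq (h : S.ProdGroup) (x : X) :
    h • x = ((h (S.orbitOf x)).1 ⟨x, rfl⟩ : S.Orbit (S.orbitOf x)) := rfl

theorem smul_coe (h : S.ProdGroup) {i : S.OrbitIndex} (y : S.Orbit i) :
    h • (y : X) = ((h i).1 y : S.Orbit i) := by
  obtain ⟨y, rfl⟩ := y
  rfl

theorem orbitOf_smul (h : S.ProdGroup) (x : X) : S.orbitOf (h • x) = S.orbitOf x :=
  ((h (S.orbitOf x)).1 ⟨x, rfl⟩).2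

theorem gamma_smul (i : S.OrbitIndex) (y : X) : S.gamma i • y = S.left i.out y := rfl

theorem left_right (x y : X) : S.left (S.left x y) (S.r (x, y)).2 = x := by
  have h := S.involutive (x, y)
  exact congrArg Prod.fst h

theorem left_left (x y z : X) :
    S.left (S.left x y) (S.left (S.r (x, y)).2 z) = S.left x (S.left y z) :=
  congrArg (fun t : X × X × X => t.1) (congrFun S.braid (x, y, z))

variable {S}

/-- The second retraction is a point, so all elements of the first have the same left action. There
`[y]` acts on `[x]` as `[x]` does, and `[x]` fixes itself by square-freeness. -/
theorem left_left_eq (hS : IsMultipermutationOfLevel 2 S.r) (x y : X) :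
    S.left (S.left y x) = S.left x := by
  obtain ⟨⟨Y, s, p, hp, Z, s', q, hq, -, hZ⟩, -⟩ := hS
  have h1 : p (S.left y x) = p x :=
    calc p (S.left y x) = (s (p y, p x)).1 := (congrArg Prod.fst (hp.map_eq y x)).symm
      _ = (s (p x, p x)).1 := (hq.eq_iff _ _).1 (Subsingleton.elim _ _) _
      _ = p x := by rw [hp.map_eq, S.squareFree]
  exact Equiv.ext ((hp.eq_iff _ _).1 h1)

theorem left_eq_of_orbitOf_eq (hS : IsMultipermutationOfLevel 2 S.r) {x y : X}
    (h : S.orbitOf x = S.orbitOf y) : S.left x = S.left y := by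
  obtain ⟨⟨g, hg⟩, rfl⟩ := Quotient.exact h
  change S.left (g y) = S.left y
  induction hg using Subgroup.closure_induction generalizing y with
  | mem g hg =>
    obtain ⟨z, rfl⟩ := hg
    exact left_left_eq hS y z
  | one => rfl
  | mul g g' _ _ ih ih' =>
    rw [Equiv.Perm.mul_apply]
    exact (ih (Quotient.sound ⟨⟨g, ‹_›⟩, rfl⟩)).trans (ih' (Quotient.sound ⟨⟨g', ‹_›⟩, rfl⟩))
  | inv g hg ih =>
    have h := ih (y := g⁻¹ y) (Quotient.sound ⟨⟨g, hg⟩, rfl⟩)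
    rw [← Equiv.Perm.mul_apply, mul_inv_cancel, Equiv.Perm.one_apply] at h
    exact h.symm

theorem left_out (hS : IsMultipermutationOfLevel 2 S.r) (x : X) :
    S.left (S.orbitOf x).out = S.left x :=
  left_eq_of_orbitOf_eq hS (Quotient.out_eq (S.orbitOf x))

/-- The braid relation gives `ℒ_(ˣy) ℒ_(xʸ) = ℒ_x ℒ_y`. Here `ˣy` acts as `y`, and `xʸ` acts as `x`
because `ℒ_y` carries `xʸ` to `x`. -/
theorem left_comm (hS : IsMultipermutationOfLevel 2 S.r) (x y : X) :
    S.left x * S.left y = S.left y * S.left x := by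
  ext z
  have h := S.left_right x y
  rw [left_left_eq hS] at h
  have h' : S.left (S.r (x, y)).2 = S.left x :=
    left_eq_of_orbitOf_eq hS (by rw [← S.orbitOf_left y, h])
  have h2 := S.left_left x y z
  rw [left_left_eq hS, h'] at h2
  exact h2.symm

theorem prodGroup_comm (hS : IsMultipermutationOfLevel 2 S.r) (a b : S.ProdGroup) :
    a * b = b * a := by
  funext i
  refine Subtype.ext ?_
  change (a i).1 * (b i).1 = (b i).1 * (a i).1
  have hgen : ∀ f ∈ Set.range (fun x => S.leftRestrict x i),
      ∀ g ∈ Set.range (fun x => S.leftRestrict x i), f * g = g * f := by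
    rintro _ ⟨x, rfl⟩ _ ⟨y, rfl⟩
    ext z
    exact congrArg (fun f : Equiv.Perm X => f z) (left_comm hS x y)
  refine Subgroup.closure_induction₂ (p := fun f g _ _ => Commute f g)
    (fun f g hf hg => hgen f hf g hg) (fun _ _ => .one_left _) (fun _ _ => .one_right _)
    (fun _ _ _ _ _ _ h h' => h.mul_left h') (fun _ _ _ _ _ _ h h' => h.mul_right h')
    (fun _ _ _ _ h => h.inv_left) (fun _ _ _ _ h => h.inv_right) (a i).2 (b i).2

theorem r_eq (hS : IsMultipermutationOfLevel 2 S.r) (x y : X) :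
    S.r (x, y) = (S.gamma (S.orbitOf x) • y, (S.gamma (S.orbitOf y))⁻¹ • x) := by
  refine Prod.ext ?_ ?_
  · rw [gamma_smul, left_out hS, left_apply]
  · rw [eq_inv_smul_iff, gamma_smul, left_out hS, ← left_left_eq hS y x, left_right]

/-- The degree on exponent vectors with `x ↦ γ^i` for `x ∈ X_i`. -/
noncomputable def degree (hS : IsMultipermutationOfLevel 2 S.r) :
    InvariantDegree S.ProdGroup X :=
  .ofComm (prodGroup_comm hS) (fun x => S.gamma (S.orbitOf x)) fun g x => by
    rw [S.orbitOf_smul]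

theorem degX_degree (hS : IsMultipermutationOfLevel 2 S.r) (x : X) :
    (degree hS).degX x = S.gamma (S.orbitOf x) := InvariantDegree.degX_ofComm _ _ _ _

/-! ### The coaction on `V` and its extension -/

variable {k : Type v} [Field k]

open FunctionAlgebra in
-- The function `δ_π` on `ℋ` is the sum of the `δ_h` with `h_i = π`. Summing over `ℋ` instead of
-- `𝒢_i` exhibits a graded action.
theorem coaction_single [Finite X] [Fintype S.ProdGroup] (x : X) :
    S.coaction k (.single x 1) = ∑ h : S.ProdGroup, Finsupp.single (h • x) (1 : k) ⊗ₜ[k]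
      (delta k h ⊗ₜ[k] MonoidAlgebra.single (S.gamma (S.orbitOf x)) (1 : k)) := by
  classical
  let _ : Fintype (S.orbitGroup (S.orbitOf x)) := Fintype.ofFinite _
  have hδ (π : S.orbitGroup (S.orbitOf x)) : S.deltaAt k (S.orbitOf x) π =
      ∑ h : S.ProdGroup, if h (S.orbitOf x) = π then delta k h else 0 := by
    ext g
    rw [deltaAt, eval_comap, eval_delta, map_sum, Finset.sum_eq_single g]
    · simp [apply_ite (eval k g), eval_delta]
    · intro h _ hh
      simp [apply_ite (eval k g), eval_delta, hh.symm]
    · simp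
  rw [coaction, Finsupp.linearCombination_single, one_smul]
  simp only [hδ, TensorProduct.sum_tmul, TensorProduct.tmul_sum]
  rw [Finset.sum_comm]
  refine Finset.sum_congr rfl fun h _ => ?_
  rw [Finset.sum_eq_single (h (S.orbitOf x))]
  · rw [if_pos rfl, smul_eq]
  · intro π _ hπ
    rw [if_neg hπ.symm, TensorProduct.zero_tmul, TensorProduct.tmul_zero]
  · simp

theorem isRightComodule_coaction [Finite X] : IsRightComodule (S.coaction k) :=
  let _ := Fintype.ofFinite S.ProdGroup
  isRightComodule_of_graded_action (Finsupp.basisSingleOne (ι := X) (R := k)) (· • ·) (one_smul _)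
    mul_smul (fun x => S.gamma (S.orbitOf x)) (fun g x => by rw [S.orbitOf_smul]) _ fun x => by
      simpa using coaction_single x

theorem polyCoaction_polyIncl [Finite X] [Fintype S.ProdGroup]
    (hS : IsMultipermutationOfLevel 2 S.r) (v : X →₀ k) :
    (degree hS).polyCoaction k (polyIncl k X v) =
      (polyIncl k X).rTensor (S.H k) (S.coaction k v) := by
  have h : ((degree hS).polyCoaction k).toLinearMap ∘ₗ polyIncl k X =
      (polyIncl k X).rTensor (S.H k) ∘ₗ S.coaction k := by
    refine Finsupp.lhom_ext' fun x => LinearMap.ext_ring ?_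
    have hd : (degree hS).deg (.single x 1) = S.gamma (S.orbitOf x) := degX_degree hS x
    simp only [LinearMap.comp_apply, Finsupp.lsingle_apply, coaction_single, map_sum,
      LinearMap.rTensor_tmul, polyIncl, Finsupp.linearCombination_single, one_smul,
      AlgHom.toLinearMap_apply, MvPolynomial.X, InvariantDegree.polyCoaction_monomial,
      expAct_single, hd]
  exact LinearMap.congr_fun h v

/-! ### The Yang–Baxter algebra and the quantum space -/

theorem YBAlgebra.respects_gen (hS : IsMultipermutationOfLevel 2 S.r) :
    (degree hS).Respects (YBAlgebra.gen S k) := by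
  intro x y
  -- With second entry `(γ^i)⁻¹ y`, which lies in the orbit of `y`, `r` returns `(y, (γ^j)⁻¹ x)`.
  have h := RingQuot.mkAlgHom_rel k
    (YBRel.of (k := k) _ _ _ _ (r_eq hS x ((S.gamma (S.orbitOf x))⁻¹ • y)))
  rw [map_mul, map_mul, smul_inv_smul, S.orbitOf_smul] at h
  rw [degX_degree, degX_degree]
  exact h

theorem YBAlgebra.adjoin_range_gen : Algebra.adjoin k (Set.range (YBAlgebra.gen S k)) = ⊤ := by
  have h : Set.range (YBAlgebra.gen S k) =
      RingQuot.mkAlgHom k (S.YBRel k) '' Set.range (FreeAlgebra.ι k) := by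
    rw [← Set.range_comp]; rfl
  rw [h, ← AlgHom.map_adjoin, FreeAlgebra.adjoin_range_ι, Algebra.map_top,
    AlgHom.range_eq_top]
  exact RingQuot.mkAlgHom_surjective k _

theorem YBAlgebra.exists_equiv [Finite X] [Fintype S.ProdGroup]
    (hS : IsMultipermutationOfLevel 2 S.r) :
    ∃ Ψ : S.YBAlgebra k ≃ₗ[k] MvPolynomial X k, Ψ 1 = 1 ∧
      (∀ a b, Ψ (a * b) = (degree hS).twMul k (Ψ a) (Ψ b)) ∧
      ∀ x, Ψ (YBAlgebra.gen S k x) = .X x := by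
  refine InvariantDegree.exists_twMul_equiv (YBAlgebra.respects_gen hS)
    YBAlgebra.adjoin_range_gen
    (RingQuot.liftAlgHom k ⟨FreeAlgebra.lift k ((degree hS).leftMulX k), ?_⟩) fun x => ?_
  · rintro _ _ ⟨x, y, z, t, h⟩
    -- Since `y = d_x⁻¹ z` and `t = d_z⁻¹ x`, the relation `xy = zt` is the untwisted one for the
    -- pair `x`, `z`.
    have hxy := (degree hS).respects_leftMulX (k := k) x z
    rw [r_eq hS] at h
    obtain ⟨rfl, rfl⟩ := Prod.mk.inj h
    rw [degX_degree, degX_degree, inv_smul_smul, S.orbitOf_smul] at hxy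
    simpa using hxy
  · rw [YBAlgebra.gen, RingQuot.liftAlgHom_mkAlgHom_apply, FreeAlgebra.lift_ι_apply]

theorem linearR_single (x y : X) :
    S.linearR k (Finsupp.single x 1 ⊗ₜ Finsupp.single y 1) =
      Finsupp.single (S.r (x, y)).1 1 ⊗ₜ Finsupp.single (S.r (x, y)).2 1 := by
  simp [linearR]

theorem tensorMul_tmul {V : Type*} [AddCommGroup V] [Module k V] (v w : V) :
    tensorMul (k := k) (v ⊗ₜ[k] w) = TensorAlgebra.ι k v * TensorAlgebra.ι k w := rfl

theorem quantumSpace_respects (hS : IsMultipermutationOfLevel 2 S.r) :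
    (degree hS).Respects fun x => QuantumSpace.ι (S.linearR k) (Finsupp.single x 1) := by
  intro x y
  have h := RingQuot.mkAlgHom_rel k (QuantumRel.of (R := S.linearR k) (.single x 1)
    (.single ((S.gamma (S.orbitOf x))⁻¹ • y) 1))
  rw [linearR_single, r_eq hS, smul_inv_smul, S.orbitOf_smul, tensorMul_tmul, tensorMul_tmul,
    map_mul, map_mul] at h
  rw [degX_degree, degX_degree]
  exact h

theorem quantumSpace_adjoin :
    Algebra.adjoin k (Set.range fun x => QuantumSpace.ι (S.linearR k) (Finsupp.single x 1)) =
      ⊤ := by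
  have hι : ∀ v, QuantumSpace.ι (S.linearR k) v ∈ Algebra.adjoin k
      (Set.range fun x => QuantumSpace.ι (S.linearR k) (Finsupp.single x 1)) := by
    intro v
    induction v using Finsupp.induction_linear with
    | zero => rw [map_zero]; exact zero_mem _
    | add v w hv hw => rw [map_add]; exact add_mem hv hw
    | single x c =>
      rw [← mul_one c, ← smul_eq_mul, ← Finsupp.smul_single, map_smul]
      exact Subalgebra.smul_mem _ (Algebra.subset_adjoin (Set.mem_range_self x)) c
  refine Algebra.eq_top_iff.2 fun a => ?_
  obtain ⟨a, rfl⟩ := RingQuot.mkAlgHom_surjective k (QuantumRel (S.linearR k)) a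
  induction a using TensorAlgebra.induction with
  | algebraMap c => rw [AlgHom.commutes]; exact Subalgebra.algebraMap_mem _ c
  | ι v => exact hι v
  | mul a b ha hb => rw [map_mul]; exact mul_mem ha hb
  | add a b ha hb => rw [map_add]; exact add_mem ha hb

theorem quantumSpace_exists_equiv [Finite X] [Fintype S.ProdGroup]
    (hS : IsMultipermutationOfLevel 2 S.r) :
    ∃ Φ : QuantumSpace (S.linearR k) ≃ₗ[k] MvPolynomial X k, Φ 1 = 1 ∧
      (∀ a b, Φ (a * b) = (degree hS).twMul k (Φ a) (Φ b)) ∧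
      ∀ v, Φ (QuantumSpace.ι (S.linearR k) v) = polyIncl k X v := by
  let L := Finsupp.linearCombination k ((degree hS).leftMulX k)
  have hL (x) : L (.single x 1) = (degree hS).leftMulX k x := by
    rw [Finsupp.linearCombination_single, one_smul]
  have hrel : ∀ ⦃a b⦄, QuantumRel (S.linearR k) a b →
      TensorAlgebra.lift k L a = TensorAlgebra.lift k L b := by
    rintro _ _ ⟨v, w⟩
    -- Both sides of the relation are linear in `v ⊗ w`, so basis vectors suffice.
    have h : (TensorAlgebra.lift k L).toLinearMap ∘ₗ tensorMul =
        (TensorAlgebra.lift k L).toLinearMap ∘ₗ tensorMul ∘ₗ S.linearR k := by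
      refine TensorProduct.ext (Finsupp.lhom_ext' fun x => LinearMap.ext_ring
        (Finsupp.lhom_ext' fun y => LinearMap.ext_ring ?_))
      change TensorAlgebra.lift k L (tensorMul (.single x 1 ⊗ₜ .single y 1)) =
        TensorAlgebra.lift k L (tensorMul (S.linearR k (.single x 1 ⊗ₜ .single y 1)))
      have hxy := (degree hS).respects_leftMulX (k := k) x (S.gamma (S.orbitOf x) • y)
      rw [degX_degree, degX_degree, inv_smul_smul, S.orbitOf_smul] at hxy
      rw [linearR_single, r_eq hS, tensorMul_tmul, tensorMul_tmul, map_mul, map_mul,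
        TensorAlgebra.lift_ι_apply, TensorAlgebra.lift_ι_apply, TensorAlgebra.lift_ι_apply,
        TensorAlgebra.lift_ι_apply, hL, hL, hL, hL, hxy]
    exact LinearMap.congr_fun h (v ⊗ₜ[k] w)
  let ρ : QuantumSpace (S.linearR k) →ₐ[k] Module.End k (MvPolynomial X k) :=
    RingQuot.liftAlgHom k ⟨TensorAlgebra.lift k L, hrel⟩
  obtain ⟨Φ, h1, hmul, hX⟩ := InvariantDegree.exists_twMul_equiv (quantumSpace_respects hS)
    quantumSpace_adjoin ρ fun x => by
      rw [QuantumSpace.ι, LinearMap.comp_apply, AlgHom.toLinearMap_apply,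
        RingQuot.liftAlgHom_mkAlgHom_apply, TensorAlgebra.lift_ι_apply, hL]
  refine ⟨Φ, h1, hmul, fun v => ?_⟩
  have h : Φ.toLinearMap ∘ₗ QuantumSpace.ι (S.linearR k) = polyIncl k X := by
    refine Finsupp.lhom_ext' fun x => LinearMap.ext_ring ?_
    refine (hX x).trans ?_
    simp [polyIncl]
  exact LinearMap.congr_fun h v

end SquareFreeSymmetricSet

theorem proposition6p6 {k : Type v} [Field k] {X : Type u} [Finite X]
    (S : SquareFreeSymmetricSet X) (hS : IsMultipermutationOfLevel 2 S.r) :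
    -- each `x ∈ X_i` acts on `X_j` by `σ^i_j`
    (∀ (i j : S.OrbitIndex) (x : S.Orbit i) (y : S.Orbit j),
      ((S.sigma i j).1 y : X) = S.left x y) ∧
    -- `V = kX` is a right comodule over the Hopf algebra `H = k(ℋ) ⊗ kℋ`
    IsRightComodule (S.coaction k) ∧
    -- the canonical map `F` is a Hopf algebra 2-cocycle on `H`
    IsHopfTwoCocycle (canonicalCocycle k S.ProdGroup) ∧
    -- the coaction extends multiplicatively to `k[V]`, making it an `H`-comodule algebra
    ∃ Δ : MvPolynomial X k →ₐ[k] MvPolynomial X k ⊗[k] S.H k,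
      (∀ v : X →₀ k, Δ (polyIncl k X v) = (polyIncl k X).rTensor (S.H k) (S.coaction k v)) ∧
      IsRightComodule Δ.toLinearMap ∧
      -- the cotwisted product `•` is associative and unital on the vector space `k[V]`
      (∀ f g h, cotwistMul Δ.toLinearMap (canonicalCocycle k S.ProdGroup)
          (cotwistMul Δ.toLinearMap (canonicalCocycle k S.ProdGroup) f g) h =
        cotwistMul Δ.toLinearMap (canonicalCocycle k S.ProdGroup) f
          (cotwistMul Δ.toLinearMap (canonicalCocycle k S.ProdGroup) g h)) ∧
      (∀ f, cotwistMul Δ.toLinearMap (canonicalCocycle k S.ProdGroup) 1 f = f ∧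
        cotwistMul Δ.toLinearMap (canonicalCocycle k S.ProdGroup) f 1 = f) ∧
      -- `x • y = x · σ^i_j(y)` for `x ∈ X_i`, `y ∈ X_j`
      (∀ (i j : S.OrbitIndex) (x : S.Orbit i) (y : S.Orbit j),
        cotwistMul Δ.toLinearMap (canonicalCocycle k S.ProdGroup)
            (MvPolynomial.X (x : X)) (MvPolynomial.X (y : X)) =
          MvPolynomial.X (x : X) * MvPolynomial.X ((S.sigma i j).1 y : X)) ∧
      -- `k_R[V] ≅ k[V]^F` as algebras, identically on `V`
      (∃ Φ : QuantumSpace (S.linearR k) ≃ₗ[k] MvPolynomial X k,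
        Φ 1 = 1 ∧
        (∀ a b, Φ (a * b) =
          cotwistMul Δ.toLinearMap (canonicalCocycle k S.ProdGroup) (Φ a) (Φ b)) ∧
        ∀ v, Φ (QuantumSpace.ι (S.linearR k) v) = polyIncl k X v) ∧
      -- `𝒜(k, X, r) ≅ k[V]^F` as algebras, identically on `X`
      (∃ Ψ : S.YBAlgebra k ≃ₗ[k] MvPolynomial X k,
        Ψ 1 = 1 ∧
        (∀ a b, Ψ (a * b) =
          cotwistMul Δ.toLinearMap (canonicalCocycle k S.ProdGroup) (Ψ a) (Ψ b)) ∧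
        ∀ x, Ψ (SquareFreeSymmetricSet.YBAlgebra.gen S k x) = MvPolynomial.X x) := by
  let _ := Fintype.ofFinite S.ProdGroup
  let _ := S.prodAction
  let D := SquareFreeSymmetricSet.degree hS
  refine ⟨fun i j x y => ?_, S.isRightComodule_coaction,
    isHopfTwoCocycle_canonicalCocycle (SquareFreeSymmetricSet.prodGroup_comm hS), D.polyCoaction k,
    SquareFreeSymmetricSet.polyCoaction_polyIncl hS, D.isRightComodule_polyCoaction, D.twMul_assoc,
    fun f => ⟨D.one_twMul f, D.twMul_one f⟩, fun i j x y => ?_,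
    SquareFreeSymmetricSet.quantumSpace_exists_equiv hS,
    SquareFreeSymmetricSet.YBAlgebra.exists_equiv hS⟩
  · obtain ⟨x, rfl⟩ := x
    exact congrArg (fun f : Equiv.Perm X => f y) (SquareFreeSymmetricSet.left_out hS x)
  · obtain ⟨x, rfl⟩ := x
    refine (D.twMul_X_X x y).trans ?_
    rw [SquareFreeSymmetricSet.degX_degree, S.smul_coe]
    rfl
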